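/- Let $m\ge 2$ and let $\mathcal H_1,\dots,\mathcal H_m$ be real Hilbert spaces; endow $\mathcal H_1\times\cdots\times\mathcal H_m$ with the Hilbert norm $\|(x_i)_i\|=(\sum_{i=1}^m\|x_i\|^2)^{1/2}$. For every $i\in\{1,\dots,m\}$ let $A_i\colon\mathcal H_i\to 2^{\mathcal H_i}$ be maximal monotone and let $B_i\colon\mathcal H_1\times\cdots\times\mathcal H_m\to\mathcal H_i$. Suppose that for some $\beta>0$ and all $x=(x_i)_i$, $y=(y_i)_i$ in $\mathcal H_1\times\cdots\times\mathcal H_m$, $$\sum_{i=1}^m\langle B_i x-B_i y,\;x_i-y_i\rangle\;\ge\;\beta\sum_{i=1}^m\|B_i x-B_i y\|^2 ,$$ and that the problem $$\text{find } (x_1,\dots,x_m)\in\mathcal H_1\times\cdots\times\mathcal H_m \text{ such that } 0\in A_i x_i+B_i(x_1,\dots,x_m)\quad\text{for all } i\in\{1,\dots,m\}\qquad(\mathrm P)$$ has at least one solution. For a maximal monotone operator $A$, let $J_A=(\mathrm{Id}+A)^{-1}$ be its resolvent. Let $\varepsilon\in\,]0,\min\{1,\beta\}[$, let $(\gamma_n)_{n\in\mathbb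 N}$ be a sequence in $[\varepsilon,2\beta-\varepsilon]$ and let $(\lambda_n)_{n\in\mathbb N}$ be a sequence in $[0,1-\varepsilon]$. For every $i\in\{1,\dots,m\}$ assume the following. 1. $(A_{i,n})_{n\in\mathbb N}$ are maximal monotone operators from $\mathcal H_i$ to $2^{\mathcal H_i}$ such that, for every $\rho>0$, $\sum_{n\in\mathbb N}\sup_{\|y\|\le\rho}\|J_{\gamma_nA_{i,n}}y-J_{\gamma_nA_i}y\|<+\infty$. 2. $(B_{i,n})_{n\in\mathbb N}$ are operators from $\mathcal H_1\times\cdots\times\mathcal H_m$ to $\mathcal H_i$ such that $B_{i,n}-B_i$ is Lipschitz continuous with a constant $\kappa_{i,n}>0$, $\sum_{n\in\mathbb N}\kappa_{i,n}<+\infty$, and there is a point $z\in\mathcal H_1\times\cdots\times\mathcal H_m$, independent of $i$, with $B_{i,n}z=B_iz$ for all $n\in\mathbb N$. 3. $(a_{i,n})_{n\in\mathbb N}$ and $(b_{i,n})_{n\in\mathbb N}$ are sequences in $\mathcal H_i$ with $\sum_{n\in\mathbb N}\|a_{i,n}\|<+\infty$ and $\sum_{n\in\mathbb N}\|b_{i,n}\|<+\infty$.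 4. $(\lambda_{i,n})_{n\in\mathbb N}$ is a sequence in $[0,1[$ with $\sum_{n\in\mathbb N}|\lambda_{i,n}-\lambda_n|<+\infty$. Let $(x_{1,0},\dots,x_{m,0})\in\mathcal H_1\times\cdots\times\mathcal H_m$ be arbitrary and, for every $n\in\mathbb N$ and every $i\in\{1,\dots,m\}$, set $$x_{i,n+1}=\lambda_{i,n}x_{i,n}+(1-\lambda_{i,n})\Big(J_{\gamma_nA_{i,n}}\big(x_{i,n}-\gamma_n(B_{i,n}(x_{1,n},\dots,x_{m,n})+b_{i,n})\big)+a_{i,n}\Big).$$ Then, for every $i\in\{1,\dots,m\}$, $(x_{i,n})_{n\in\mathbb N}$ converges weakly to a point $x_i\in\mathcal H_i$, and $(x_1,\dots,x_m)$ is a solution of $(\mathrm P)$. -/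

import Mathlib

open Filter Topology
open scoped Pointwise NNReal ENNReal InnerProductSpace

/-- A set-valued operator `A : H → 2^H` on a real Hilbert space is monotone if
`⟪x - y, u - v⟫ ≥ 0` whenever `u ∈ A x` and `v ∈ A y`. -/
def IsMonotoneOperator {H : Type*} [NormedAddCommGroup H] [InnerProductSpace ℝ H]
    (A : H → Set H) : Prop :=
  ∀ x y u v : H, u ∈ A x → v ∈ A y → 0 ≤ ⟪x - y, u - v⟫_ℝ

/-- A set-valued operator is maximal monotone if it is monotone and its graph is not properly
contained in the graph of another monotone operator. The order on `H → Set H` is pointwise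
inclusion, that is, inclusion of graphs. -/
def IsMaximalMonotone {H : Type*} [NormedAddCommGroup H] [InnerProductSpace ℝ H]
    (A : H → Set H) : Prop :=
  Maximal IsMonotoneOperator A

open Classical in
/-- The resolvent `J_A = (Id + A)⁻¹`: `resolventMap A y` is the point `p` with `y ∈ p + A p`.
For a monotone operator there is at most one such point, and for a maximal monotone operator on a
Hilbert space there is exactly one for every `y`; the value `0` is used where there is none. -/
noncomputable def resolventMap {H : Type*} [NormedAddCommGroup H] [InnerProductSpace ℝ H]
    (A : H → Set H) (y : H) : H :=
  if h : ∃ p : H, y ∈ {p} + A p then h.choose else 0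

/-- `x = (x₁, …, x_m)` satisfies `0 ∈ A_i x_i + B_i(x₁, …, x_m)` for every `i`. -/
def SolvesCoupledInclusions {m : ℕ} {H : Fin m → Type*}
    [∀ i, NormedAddCommGroup (H i)] [∀ i, InnerProductSpace ℝ (H i)]
    (A : ∀ i, H i → Set (H i)) (B : ∀ i, PiLp 2 H → H i) (x : PiLp 2 H) : Prop :=
  ∀ i, (0 : H i) ∈ A i (x i) + {B i x}

/-- The family `(B_i)` is jointly cocoercive with constant `β`. -/
def JointlyCocoercive {m : ℕ} {H : Fin m → Type*}
    [∀ i, NormedAddCommGroup (H i)] [∀ i, InnerProductSpace ℝ (H i)]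
    (β : ℝ) (B : ∀ i, PiLp 2 H → H i) : Prop :=
  ∀ x y : PiLp 2 H,
    β * ∑ i, ‖B i x - B i y‖ ^ 2 ≤ ∑ i, ⟪B i x - B i y, x i - y i⟫_ℝ

/-- Weak convergence of a sequence in a real Hilbert space. -/
def ConvergesWeakly {H : Type*} [NormedAddCommGroup H] [InnerProductSpace ℝ H]
    (u : ℕ → H) (l : H) : Prop :=
  Tendsto (fun n => toWeakSpace ℝ H (u n)) atTop (𝓝 (toWeakSpace ℝ H l))

/-! In the Hilbert product, (P) reads `0 ∈ A x + B x` with `A` the product of the `A i`, again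
maximal monotone, and `B` cocoercive. Since resolvents of the product act coordinatewise, the scheme
is a single forward-backward iteration, perturbed in its operators, values and relaxations.

For the exact step, cocoercivity and firm nonexpansiveness give (`sq_norm_forwardBackward_sub_le`)
that the squared distance to any solution `z` drops by multiples of `‖B x - B z‖ ^ 2` and of a
squared residual. Summable errors preserve convergence of the distances and force both quantities to
zero. Weak cluster points then solve the inclusion (`neg_mem_of_weak_cluster_point`), and Opial's
lemma concludes.

The perturbations become summable errors once the orbit is bounded. Boundedness comes first, by
comparison with one solution `z`: the perturbed resolvents are nonexpansive, so their approximation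
error is only needed at forward images of `z`, which stay in a fixed ball. A second use of the same
hypothesis, on a ball containing the forward images of the orbit, reduces everything to the inexact
iteration.

Existence of resolvents is Minty's theorem, proved by minimisation over a simplex for finitely many
graph points and then weak compactness. -/

/-! ### Weak limits and Opial's lemma -/

section WeakLimits

variable {H : Type*} [NormedAddCommGroup H] [InnerProductSpace ℝ H]

/-- Along an ultrafilter, an eventually bounded family in a Hilbert space has a weak limit. -/
lemma exists_tendsto_inner_of_ultrafilter [CompleteSpace H] {ι : Type*} (U : Ultrafilter ι)
    (x : ι → H) {R : ℝ} (hR : ∀ᶠ n in (U : Filter ι), ‖x n‖ ≤ R) :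
    ∃ l : H, ∀ y : H, Tendsto (fun n => ⟪x n, y⟫_ℝ) U (𝓝 ⟪l, y⟫_ℝ) := by
  let f : ι → WeakDual ℝ H := fun n =>
    StrongDual.toWeakDual (InnerProductSpace.toDual ℝ H (x n))
  have hc := WeakDual.isCompact_closedBall (0 : StrongDual ℝ H) R
  obtain ⟨l, -, hl⟩ := hc.ultrafilter_le_nhds (U.map f) (by
    rw [le_principal_iff, Ultrafilter.coe_map, mem_map]
    filter_upwards [hR] with n hn
    simpa [f] using hn)
  refine ⟨(InnerProductSpace.toDual ℝ H).symm (WeakDual.toStrongDual l), fun y => ?_⟩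
  have h1 : Tendsto f U (𝓝 l) := hl
  have h2 := ((WeakDual.eval_continuous y).tendsto l).comp h1
  simpa [f, Function.comp_def, InnerProductSpace.toDual_symm_apply] using h2

/-- Pairing a weakly convergent with a strongly convergent family. -/
lemma tendsto_inner_of_weak_of_strong {ι : Type*} {F : Filter ι} {x u : ι → H} {l v : H} {R : ℝ}
    (hR : ∀ n, ‖x n‖ ≤ R)
    (hx : ∀ y : H, Tendsto (fun n => ⟪x n, y⟫_ℝ) F (𝓝 ⟪l, y⟫_ℝ))
    (hu : Tendsto u F (𝓝 v)) :
    Tendsto (fun n => ⟪x n, u n⟫_ℝ) F (𝓝 ⟪l, v⟫_ℝ) := by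
  have h1 : Tendsto (fun n => ⟪x n, u n - v⟫_ℝ) F (𝓝 0) := by
    have h2 : Tendsto (fun n => R * ‖u n - v‖) F (𝓝 0) := by
      have := (tendsto_iff_norm_sub_tendsto_zero.1 hu).const_mul R
      simpa using this
    refine squeeze_zero_norm (fun n => ?_) h2
    exact (norm_inner_le_norm _ _).trans
      (mul_le_mul_of_nonneg_right (hR n) (norm_nonneg _))
  have h3 := h1.add (hx v)
  simpa [inner_sub_right] using h3

lemma convergesWeakly_of_tendsto_inner [CompleteSpace H] {u : ℕ → H} {l : H}
    (h : ∀ y : H, Tendsto (fun n => ⟪u n, y⟫_ℝ) atTop (𝓝 ⟪l, y⟫_ℝ)) : ConvergesWeakly u l := by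
  unfold ConvergesWeakly
  have hinj : Function.Injective (topDualPairing ℝ H).flip := by
    intro a b hab
    refine ext_inner_right ℝ fun y => ?_
    have := congrArg (fun f => f (InnerProductSpace.toDual ℝ H y)) hab
    simpa [real_inner_comm] using this
  refine (WeakBilin.tendsto_iff_forall_eval_tendsto _ hinj).2 fun f => ?_
  have := h ((InnerProductSpace.toDual ℝ H).symm f)
  have hf : ∀ v : H, ⟪v, (InnerProductSpace.toDual ℝ H).symm f⟫_ℝ = f v := fun v => by
    rw [real_inner_comm, InnerProductSpace.toDual_symm_apply]
  simp only [hf] at this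
  exact this

/-- **Opial's lemma**: a bounded sequence whose distance to each point of `S` converges, and whose
weak cluster points all lie in `S`, converges weakly to a point of `S`. -/
lemma exists_weak_limit_of_opial [CompleteSpace H] {x : ℕ → H} {S : Set H} {R : ℝ}
    (hR : ∀ n, ‖x n‖ ≤ R)
    (hdist : ∀ z ∈ S, ∃ d : ℝ, Tendsto (fun n => ‖x n - z‖ ^ 2) atTop (𝓝 d))
    (hcl : ∀ (U : Ultrafilter ℕ) (l : H), (U : Filter ℕ) ≤ atTop →
      (∀ y : H, Tendsto (fun n => ⟪x n, y⟫_ℝ) U (𝓝 ⟪l, y⟫_ℝ)) → l ∈ S) :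
    ∃ l ∈ S, ∀ y : H, Tendsto (fun n => ⟪x n, y⟫_ℝ) atTop (𝓝 ⟪l, y⟫_ℝ) := by
  have hex : ∀ U : Ultrafilter ℕ, ∃ l : H, ∀ y : H,
      Tendsto (fun n => ⟪x n, y⟫_ℝ) U (𝓝 ⟪l, y⟫_ℝ) := fun U =>
    exists_tendsto_inner_of_ultrafilter U x (Eventually.of_forall hR)
  have huniq : ∀ (U V : Ultrafilter ℕ) (l k : H), (U : Filter ℕ) ≤ atTop →
      (V : Filter ℕ) ≤ atTop → (∀ y : H, Tendsto (fun n => ⟪x n, y⟫_ℝ) U (𝓝 ⟪l, y⟫_ℝ)) →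
      (∀ y : H, Tendsto (fun n => ⟪x n, y⟫_ℝ) V (𝓝 ⟪k, y⟫_ℝ)) → l = k := by
    intro U V l k hU hV hl hk
    obtain ⟨d, hd⟩ := hdist l (hcl U l hU hl)
    obtain ⟨e, he⟩ := hdist k (hcl V k hV hk)
    -- Up to constants this pairing is half the difference of the squared distances to `k` and `l`,
    -- so it converges along the whole sequence and takes the same limit along `U` and `V`.
    have hlim : Tendsto (fun n => ⟪x n, l - k⟫_ℝ) atTop
        (𝓝 ((‖l‖ ^ 2 - ‖k‖ ^ 2 - (d - e)) / 2)) := by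
      refine (((hd.sub he).const_sub _).div_const 2).congr fun n => ?_
      rw [norm_sub_sq_real, norm_sub_sq_real, inner_sub_right]
      ring
    have h1 := tendsto_nhds_unique (hl (l - k)) (hlim.mono_left hU)
    have h2 := tendsto_nhds_unique (hk (l - k)) (hlim.mono_left hV)
    have h3 : ⟪l - k, l - k⟫_ℝ = 0 := by rw [inner_sub_left, h1, h2, sub_self]
    exact sub_eq_zero.1 (inner_self_eq_zero.1 h3)
  obtain ⟨l, hl⟩ := hex (Ultrafilter.of atTop)
  refine ⟨l, hcl _ l (Ultrafilter.of_le _) hl, fun y => ?_⟩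
  rw [tendsto_iff_ultrafilter]
  intro V hV
  obtain ⟨k, hk⟩ := hex V
  rw [huniq _ V l k (Ultrafilter.of_le _) hV hl hk]
  exact hk y

end WeakLimits

/-! ### Quasi-Fejér recursions for real sequences -/

section RealSequences

/-- Discrete Gronwall: since `1 + η n ≤ exp (η n)`, the growth factors multiply to at most `exp (∑
η)`. -/
lemma exists_bound_of_le_one_add_mul_add {α η θ : ℕ → ℝ} (hα : ∀ n, 0 ≤ α n)
    (hη : ∀ n, 0 ≤ η n) (hθ : ∀ n, 0 ≤ θ n) (hηs : Summable η) (hθs : Summable θ)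
    (h : ∀ n, α (n + 1) ≤ (1 + η n) * α n + θ n) : ∃ C, ∀ n, α n ≤ C := by
  have key : ∀ n, α n ≤ Real.exp (∑ k ∈ Finset.range n, η k) *
      (α 0 + ∑ k ∈ Finset.range n, θ k) := by
    intro n
    induction n with
    | zero => simp
    | succ n ih =>
      rw [Finset.sum_range_succ, Finset.sum_range_succ, Real.exp_add]
      have hE : 1 ≤ Real.exp (∑ k ∈ Finset.range n, η k) :=
        Real.one_le_exp (Finset.sum_nonneg fun k _ => hη k)
      have he : 1 + η n ≤ Real.exp (η n) := by linarith [Real.add_one_le_exp (η n)]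
      have he1 : 1 ≤ Real.exp (η n) := Real.one_le_exp (hη n)
      calc α (n + 1) ≤ (1 + η n) * α n + θ n := h n
        _ ≤ Real.exp (η n) * (Real.exp (∑ k ∈ Finset.range n, η k) *
            (α 0 + ∑ k ∈ Finset.range n, θ k)) +
            (Real.exp (∑ k ∈ Finset.range n, η k) * Real.exp (η n)) * θ n := by
          have h1 := mul_le_mul he ih (hα n) (Real.exp_pos _).le
          have h2 := mul_le_mul_of_nonneg_right (one_le_mul_of_one_le_of_one_le hE he1) (hθ n)
          linarith
        _ = _ := by ring
  refine ⟨Real.exp (∑' k, η k) * (α 0 + ∑' k, θ k), fun n => (key n).trans ?_⟩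
  have h1 := hηs.sum_le_tsum (Finset.range n) (fun k _ => hη k)
  have h2 := hθs.sum_le_tsum (Finset.range n) (fun k _ => hθ k)
  have h3 : 0 ≤ ∑ k ∈ Finset.range n, θ k := Finset.sum_nonneg fun k _ => hθ k
  have := hα 0
  gcongr

/-- Subtracting the partial sums of `τ` from `α` leaves an antitone sequence bounded below; `d n` is
then squeezed by `α n - α (n + 1) + τ n`. -/
lemma exists_tendsto_of_le_sub_add {α d τ : ℕ → ℝ} (hα : ∀ n, 0 ≤ α n) (hd : ∀ n, 0 ≤ d n)
    (hτ : Summable τ) (h : ∀ n, α (n + 1) ≤ α n - d n + τ n) :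
    (∃ l, Tendsto α atTop (𝓝 l)) ∧ Tendsto d atTop (𝓝 0) := by
  have hsum := hτ.hasSum.tendsto_sum_nat
  obtain ⟨M, hM⟩ := hsum.bddAbove_range
  have hanti : Antitone fun n => α n - ∑ k ∈ Finset.range n, τ k := by
    refine antitone_nat_of_succ_le fun n => ?_
    rw [Finset.sum_range_succ]
    linarith [h n, hd n]
  have hbdd : BddBelow (Set.range fun n => α n - ∑ k ∈ Finset.range n, τ k) := by
    refine ⟨-M, ?_⟩
    rintro _ ⟨n, rfl⟩
    have := hM ⟨n, rfl⟩
    simp only at this ⊢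
    linarith [hα n]
  have hlim := (tendsto_atTop_ciInf hanti hbdd).add hsum
  simp only [sub_add_cancel] at hlim
  refine ⟨⟨_, hlim⟩, ?_⟩
  have h0 : Tendsto (fun n => α n - α (n + 1) + τ n) atTop (𝓝 0) := by
    have := (hlim.sub (hlim.comp (tendsto_add_atTop_nat 1))).add hτ.tendsto_atTop_zero
    simpa using this
  exact squeeze_zero hd (fun n => by linarith [h n]) h0

end RealSequences

/-! ### Extending monotone families (towards Minty's theorem) -/

section Minty

variable {H : Type*} [NormedAddCommGroup H] [InnerProductSpace ℝ H]

/-- Average the monotonicity inequalities with weights `t i * t j` and expand: each side of the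
claim appears twice. -/
lemma inner_sum_smul_le_sum_inner {ι : Type*} [Fintype ι] {x u : ι → H}
    (hmono : ∀ i j, 0 ≤ ⟪x i - x j, u i - u j⟫_ℝ) {t : ι → ℝ} (ht : t ∈ stdSimplex ℝ ι) :
    ⟪∑ i, t i • x i, ∑ i, t i • u i⟫_ℝ ≤ ∑ i, t i * ⟪x i, u i⟫_ℝ := by
  have h0 : 0 ≤ ∑ i, ∑ j, t i * t j * ⟪x i - x j, u i - u j⟫_ℝ :=
    Finset.sum_nonneg fun i _ => Finset.sum_nonneg fun j _ =>
      mul_nonneg (mul_nonneg (ht.1 i) (ht.1 j)) (hmono i j)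
  have hA : ∑ i, ∑ j, t i * t j * ⟪x i, u i⟫_ℝ = ∑ i, t i * ⟪x i, u i⟫_ℝ := by
    refine Finset.sum_congr rfl fun i _ => ?_
    rw [← Finset.sum_mul, ← Finset.mul_sum, ht.2, mul_one]
  have hD : ∑ i, ∑ j, t i * t j * ⟪x j, u j⟫_ℝ = ∑ i, t i * ⟪x i, u i⟫_ℝ := by
    rw [Finset.sum_comm, ← hA]
    exact Finset.sum_congr rfl fun i _ => Finset.sum_congr rfl fun j _ => by ring
  have hB : ∑ i, ∑ j, t i * t j * ⟪x i, u j⟫_ℝ = ⟪∑ i, t i • x i, ∑ i, t i • u i⟫_ℝ := by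
    simp only [sum_inner, inner_sum, real_inner_smul_left, real_inner_smul_right, mul_assoc]
    rw [Finset.sum_comm]
    exact Finset.sum_congr rfl fun i _ => Finset.sum_congr rfl fun j _ => mul_left_comm _ _ _
  have hC : ∑ i, ∑ j, t i * t j * ⟪x j, u i⟫_ℝ = ⟪∑ i, t i • x i, ∑ i, t i • u i⟫_ℝ := by
    rw [← hB, Finset.sum_comm]
    exact Finset.sum_congr rfl fun i _ => Finset.sum_congr rfl fun j _ => by ring
  have h1 : ∑ i, ∑ j, t i * t j * ⟪x i - x j, u i - u j⟫_ℝ =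
      ∑ i, ∑ j, t i * t j * ⟪x i, u i⟫_ℝ - ∑ i, ∑ j, t i * t j * ⟪x i, u j⟫_ℝ -
        ∑ i, ∑ j, t i * t j * ⟪x j, u i⟫_ℝ + ∑ i, ∑ j, t i * t j * ⟪x j, u j⟫_ℝ := by
    simp only [← Finset.sum_add_distrib, ← Finset.sum_sub_distrib]
    refine Finset.sum_congr rfl fun i _ => Finset.sum_congr rfl fun j _ => ?_
    simp only [inner_sub_left, inner_sub_right]
    ring
  rw [hA, hB, hC, hD] at h1
  linarith

lemma nonneg_of_forall_mul_add_sq {a b : ℝ}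
    (h : ∀ s ∈ Set.Ioc (0 : ℝ) 1, 0 ≤ s * a + s ^ 2 * b) : 0 ≤ a := by
  by_contra! ha
  have hb : a + b ≥ 0 := by simpa using h 1 ⟨one_pos, le_rfl⟩
  have hb0 : 0 < b := by linarith
  -- At this `s` the expression equals `s * (a / 2) < 0`; `s ≤ 1` because the case `s = 1` gave `-a
  -- ≤ b`.
  have hs : 0 < -a / (2 * b) := div_pos (by linarith) (by linarith)
  have h1 := h (-a / (2 * b)) ⟨hs, by rw [div_le_one (by linarith)]; linarith⟩
  have h2 : -a / (2 * b) * a + (-a / (2 * b)) ^ 2 * b = -a / (2 * b) * (a / 2) := by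
    field_simp
    ring
  rw [h2] at h1
  nlinarith

/-- Finitely many monotonically related pairs `(x i, u i)` are monotonically related to a common
pair of the form `(p, -p)`. -/
lemma exists_sq_norm_le_of_finite {ι : Type*} [Fintype ι] [Nonempty ι] (x u : ι → H)
    (hmono : ∀ i j, 0 ≤ ⟪x i - x j, u i - u j⟫_ℝ) :
    ∃ p : H, ∀ i, ‖p‖ ^ 2 ≤ ⟪p, x i - u i⟫_ℝ + ⟪x i, u i⟫_ℝ := by
  classical
  let c : ι → H := fun i => (1 / 2 : ℝ) • (x i - u i)
  let k : ι → ℝ := fun i => ⟪x i, u i⟫_ℝ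
  let P : (ι → ℝ) → H := fun t => ∑ i, t i • c i
  let K : (ι → ℝ) → ℝ := fun t => ∑ i, t i * k i
  -- The desired `p` is `P t` at a minimiser `t`: first-order optimality towards vertex `j` reads `2
  -- * ‖P t‖ ^ 2 + K t ≤ 2 * ⟪P t, c j⟫ + k j`, and nonnegativity of the minimum drops one `‖P t‖ ^
  -- 2 + K t`.
  obtain ⟨t, ht, hmin⟩ := (isCompact_stdSimplex ℝ ι).exists_isMinOn
    ⟨_, single_mem_stdSimplex ℝ (Classical.arbitrary ι)⟩
    (f := fun t => ‖P t‖ ^ 2 + K t) (by fun_prop)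
  have hnn : 0 ≤ ‖P t‖ ^ 2 + K t := by
    have h1 := inner_sum_smul_le_sum_inner hmono ht
    set X := ∑ i, t i • x i
    set V := ∑ i, t i • u i
    have h2 : P t = (1 / 2 : ℝ) • (X - V) := by
      simp only [P, c, X, V, ← Finset.sum_sub_distrib, Finset.smul_sum, ← smul_sub]
      exact Finset.sum_congr rfl fun i _ => smul_comm _ _ _
    have h3 : ‖P t‖ ^ 2 = 1 / 4 * ‖X - V‖ ^ 2 := by
      rw [h2, norm_smul, mul_pow]; norm_num
    have h4 := norm_sub_sq_real X V
    have h5 := norm_add_sq_real X V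
    have h6 : ⟪X, V⟫_ℝ ≤ K t := h1
    nlinarith [sq_nonneg ‖X + V‖]
  refine ⟨P t, fun j => ?_⟩
  have hdir : ∀ s ∈ Set.Ioc (0 : ℝ) 1,
      0 ≤ s * (2 * ⟪P t, c j - P t⟫_ℝ + (k j - K t)) + s ^ 2 * ‖c j - P t‖ ^ 2 := by
    intro s hs
    have hmem : (1 - s) • t + s • (Pi.single j 1 : ι → ℝ) ∈ stdSimplex ℝ ι :=
      convex_stdSimplex ℝ ι ht (single_mem_stdSimplex ℝ j) (by linarith [hs.2]) hs.1.le (by ring)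
    have h1 := hmin hmem
    have hP : P ((1 - s) • t + s • (Pi.single j 1 : ι → ℝ)) = P t + s • (c j - P t) := by
      simp only [P, Pi.add_apply, Pi.smul_apply, smul_eq_mul, add_smul, mul_smul,
        Finset.sum_add_distrib, ← Finset.smul_sum]
      rw [show ∑ i, (Pi.single j (1 : ℝ) : ι → ℝ) i • c i = c j by
        rw [Finset.sum_eq_single j] <;> simp +contextual]
      module
    have hK : K ((1 - s) • t + s • (Pi.single j 1 : ι → ℝ)) = K t + s * (k j - K t) := by
      simp only [K, Pi.add_apply, Pi.smul_apply, smul_eq_mul, add_mul, mul_assoc,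
        Finset.sum_add_distrib, ← Finset.mul_sum]
      rw [show ∑ i, (Pi.single j (1 : ℝ) : ι → ℝ) i * k i = k j by
        rw [Finset.sum_eq_single j] <;> simp +contextual]
      ring
    simp only [Set.mem_ofPred_eq] at h1
    rw [hP, hK, norm_add_sq_real, norm_smul, real_inner_smul_right, mul_pow, Real.norm_eq_abs,
      sq_abs] at h1
    linarith
  have h1 := nonneg_of_forall_mul_add_sq hdir
  rw [inner_sub_right, real_inner_self_eq_norm_sq] at h1
  have h2 : ⟪P t, c j⟫_ℝ = 1 / 2 * ⟪P t, x j - u j⟫_ℝ := real_inner_smul_right _ _ _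
  rw [h2] at h1
  change _ ≤ _ + k j
  linarith

/-- A nonempty monotone family of pairs `(x i, u i)` is monotonically related to a pair of the
form `(p, -p)`. -/
lemma exists_sq_norm_le [CompleteSpace H] {ι : Type*} [Nonempty ι] (x u : ι → H)
    (hmono : ∀ i j, 0 ≤ ⟪x i - x j, u i - u j⟫_ℝ) :
    ∃ p : H, ∀ i, ‖p‖ ^ 2 ≤ ⟪p, x i - u i⟫_ℝ + ⟪x i, u i⟫_ℝ := by
  classical
  have hfin : ∀ F : Finset ι, ∃ p : H, ∀ i ∈ F, ‖p‖ ^ 2 ≤ ⟪p, x i - u i⟫_ℝ + ⟪x i, u i⟫_ℝ := by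
    intro F
    rcases F.eq_empty_or_nonempty with rfl | hF
    · exact ⟨0, by simp⟩
    · have : Nonempty F := hF.to_subtype
      obtain ⟨p, hp⟩ := exists_sq_norm_le_of_finite (fun i : F => x i) (fun i : F => u i)
        (fun i j => hmono i j)
      exact ⟨p, fun i hi => hp ⟨i, hi⟩⟩
  choose p hp using hfin
  have hev : ∀ i, ∀ᶠ F in (Ultrafilter.of (atTop : Filter (Finset ι)) : Filter (Finset ι)),
      ‖p F‖ ^ 2 ≤ ⟪p F, x i - u i⟫_ℝ + ⟪x i, u i⟫_ℝ := fun i =>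
    Ultrafilter.of_le _ ((eventually_ge_atTop {i}).mono fun F hF =>
      hp F i (hF (Finset.mem_singleton_self i)))
  have i₀ : ι := Classical.arbitrary ι
  -- A single index `i₀` already bounds `p F`: `r ^ 2 ≤ s * r + t` with `s, t ≥ 0` forces `r ≤ s + t
  -- + 1`.
  obtain ⟨l, hl⟩ := exists_tendsto_inner_of_ultrafilter _ p
    (R := ‖x i₀ - u i₀‖ + |⟪x i₀, u i₀⟫_ℝ| + 1) ((hev i₀).mono fun F hF => by
      have h1 := real_inner_le_norm (p F) (x i₀ - u i₀)
      have h2 := le_abs_self ⟪x i₀, u i₀⟫_ℝ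
      have h3 := abs_nonneg ⟪x i₀, u i₀⟫_ℝ
      have h4 := norm_nonneg (x i₀ - u i₀)
      by_contra! hlt
      nlinarith [norm_nonneg (p F)])
  refine ⟨l, fun i => ?_⟩
  -- Weak lower semicontinuity of the squared norm, by its affine minorant `2 * ⟪p F, l⟫ - ‖l‖ ^ 2`.
  have h1 : Tendsto (fun F => 2 * ⟪p F, l⟫_ℝ - ⟪p F, x i - u i⟫_ℝ)
      (Ultrafilter.of (atTop : Filter (Finset ι))) (𝓝 (2 * ⟪l, l⟫_ℝ - ⟪l, x i - u i⟫_ℝ)) :=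
    ((hl l).const_mul 2).sub (hl _)
  have h2 := le_of_tendsto h1 (b := ‖l‖ ^ 2 + ⟪x i, u i⟫_ℝ) ((hev i).mono fun F hF => by
    have h3 := norm_sub_sq_real (p F) l
    nlinarith [sq_nonneg ‖p F - l‖])
  rw [real_inner_self_eq_norm_sq] at h2
  linarith

end Minty

/-! ### Resolvents of maximal monotone operators -/

section Resolvent

variable {H : Type*} [NormedAddCommGroup H] [InnerProductSpace ℝ H] {A : H → Set H}

/-- Adjoining `(p, w)` to the graph keeps it monotone, so maximality puts the pair in the graph. -/
lemma IsMaximalMonotone.mem_of_forall (hA : IsMaximalMonotone A) {p w : H}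
    (h : ∀ y v, v ∈ A y → 0 ≤ ⟪y - p, v - w⟫_ℝ) : w ∈ A p := by
  have hmono : IsMonotoneOperator fun x => A x ∪ {v | x = p ∧ v = w} := by
    rintro a b u v (hu | ⟨rfl, rfl⟩) (hv | ⟨rfl, rfl⟩)
    · exact hA.1 _ _ _ _ hu hv
    · exact h _ _ hu
    · have := h _ _ hv
      rwa [← neg_sub, ← neg_sub v, inner_neg_neg]
    · simp
  exact hA.2 hmono (fun x => Set.subset_union_left) p (Or.inr ⟨rfl, rfl⟩)

lemma IsMaximalMonotone.exists_mem (hA : IsMaximalMonotone A) : ∃ x u, u ∈ A x := by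
  by_contra! h
  exact h 0 0 (hA.mem_of_forall fun y v hv => absurd hv (h y v))

/-- **Minty's theorem**: the range of `Id + γ A` is the whole space. -/
lemma IsMaximalMonotone.exists_resolvent [CompleteSpace H] (hA : IsMaximalMonotone A) {γ : ℝ}
    (hγ : 0 < γ) (y : H) : ∃ p, y ∈ {p} + γ • A p := by
  obtain ⟨x₀, u₀, h₀⟩ := hA.exists_mem
  let ι := {q : H × H // q.2 ∈ A q.1}
  have : Nonempty ι := ⟨⟨(x₀, u₀), h₀⟩⟩
  -- The graph of `γ A - y` is monotonically related to some `(p, -p)`; undoing shift and scaling,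
  -- `(p, γ⁻¹ • (y - p))` is related to the graph of `A`.
  obtain ⟨p, hp⟩ := exists_sq_norm_le (fun q : ι => q.1.1) (fun q : ι => γ • q.1.2 - y)
    (fun q r => by
      rw [sub_sub_sub_cancel_right, ← smul_sub, real_inner_smul_right]
      exact mul_nonneg hγ.le (hA.1 _ _ _ _ q.2 r.2))
  have hmem : γ⁻¹ • (y - p) ∈ A p := hA.mem_of_forall fun x v hv => by
    have h1 : ‖p‖ ^ 2 ≤ ⟪p, x - (γ • v - y)⟫_ℝ + ⟪x, γ • v - y⟫_ℝ := hp ⟨(x, v), hv⟩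
    have h2 : v - γ⁻¹ • (y - p) = γ⁻¹ • (γ • v - y + p) := by
      rw [show γ • v - y + p = γ • v - (y - p) by abel, smul_sub γ⁻¹ (γ • v),
        inv_smul_smul₀ hγ.ne']
    rw [h2, real_inner_smul_right]
    refine mul_nonneg (inv_nonneg.2 hγ.le) ?_
    rw [inner_sub_right] at h1
    rw [inner_sub_left, inner_add_right, inner_add_right, real_inner_self_eq_norm_sq,
      real_inner_comm p x]
    linarith
  refine ⟨p, Set.mem_add.2 ⟨p, rfl, y - p, ?_, by abel⟩⟩
  exact Set.mem_smul_set.2 ⟨_, hmem, smul_inv_smul₀ hγ.ne' _⟩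

lemma IsMaximalMonotone.resolventMap_mem [CompleteSpace H] (hA : IsMaximalMonotone A) {γ : ℝ}
    (hγ : 0 < γ) (y : H) :
    γ⁻¹ • (y - resolventMap (fun x => γ • A x) y) ∈ A (resolventMap (fun x => γ • A x) y) := by
  have hex := hA.exists_resolvent hγ y
  have hdef : resolventMap (fun x => γ • A x) y = hex.choose := dif_pos hex
  rw [hdef]
  obtain ⟨q, hq, r, hr, hqr⟩ := Set.mem_add.1 hex.choose_spec
  obtain ⟨w, hw, hwr⟩ := Set.mem_smul_set.1 hr
  rw [Set.mem_singleton_iff] at hq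
  have : w = γ⁻¹ • (y - hex.choose) := by
    rw [← hq, sub_eq_of_eq_add' hqr.symm, ← hwr, inv_smul_smul₀ hγ.ne']
  rwa [← this]

/-- Resolvents are firmly nonexpansive. -/
lemma IsMaximalMonotone.inner_resolventMap_nonneg [CompleteSpace H] (hA : IsMaximalMonotone A)
    {γ : ℝ} (hγ : 0 < γ) (y z : H) :
    0 ≤ ⟪resolventMap (fun x => γ • A x) y - resolventMap (fun x => γ • A x) z,
      (y - resolventMap (fun x => γ • A x) y) - (z - resolventMap (fun x => γ • A x) z)⟫_ℝ := by
  have h := hA.1 _ _ _ _ (hA.resolventMap_mem hγ y) (hA.resolventMap_mem hγ z)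
  rw [← smul_sub, real_inner_smul_right] at h
  exact nonneg_of_mul_nonneg_right h (inv_pos.2 hγ)

lemma IsMaximalMonotone.sq_norm_resolventMap_sub_le [CompleteSpace H] (hA : IsMaximalMonotone A)
    {γ : ℝ} (hγ : 0 < γ) (y z : H) :
    ‖resolventMap (fun x => γ • A x) y - resolventMap (fun x => γ • A x) z‖ ^ 2 +
      ‖(y - resolventMap (fun x => γ • A x) y) - (z - resolventMap (fun x => γ • A x) z)‖ ^ 2 ≤
      ‖y - z‖ ^ 2 := by
  have h := hA.inner_resolventMap_nonneg hγ y z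
  set p := resolventMap (fun x => γ • A x) y
  set q := resolventMap (fun x => γ • A x) z
  have h1 := norm_add_sq_real (p - q) ((y - p) - (z - q))
  rw [show p - q + ((y - p) - (z - q)) = y - z by abel] at h1
  linarith

lemma IsMaximalMonotone.norm_resolventMap_sub_le [CompleteSpace H] (hA : IsMaximalMonotone A)
    {γ : ℝ} (hγ : 0 < γ) (y z : H) :
    ‖resolventMap (fun x => γ • A x) y - resolventMap (fun x => γ • A x) z‖ ≤ ‖y - z‖ := by
  have h := hA.sq_norm_resolventMap_sub_le hγ y z
  exact (sq_le_sq₀ (norm_nonneg _) (norm_nonneg _)).1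
    ((le_add_of_nonneg_right (sq_nonneg _)).trans h)

lemma IsMaximalMonotone.resolventMap_add_smul [CompleteSpace H] (hA : IsMaximalMonotone A)
    {γ : ℝ} (hγ : 0 < γ) {p w : H} (hw : w ∈ A p) :
    resolventMap (fun x => γ • A x) (p + γ • w) = p := by
  set q := resolventMap (fun x => γ • A x) (p + γ • w) with hq
  have h := hA.1 _ _ _ _ (hA.resolventMap_mem hγ (p + γ • w)) hw
  rw [← hq] at h
  have h1 : γ⁻¹ • (p + γ • w - q) - w = -(γ⁻¹ • (q - p)) := by
    rw [show p + γ • w - q = γ • w - (q - p) by abel, smul_sub, inv_smul_smul₀ hγ.ne']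
    abel
  rw [h1, inner_neg_right, real_inner_smul_right, real_inner_self_eq_norm_sq] at h
  have h2 : ‖q - p‖ ^ 2 ≤ 0 := by
    by_contra! h3
    have := mul_pos (inv_pos.2 hγ) h3
    linarith
  have h4 : ‖q - p‖ = 0 := by
    have := le_antisymm h2 (sq_nonneg _)
    exact pow_eq_zero_iff (two_ne_zero) |>.1 this
  exact sub_eq_zero.1 (norm_eq_zero.1 h4)

end Resolvent

/-! ### The forward-backward iteration -/

section ForwardBackward

variable {H : Type*} [NormedAddCommGroup H] [InnerProductSpace ℝ H] {A : H → Set H} {B : H → H}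
  {β : ℝ}

lemma sq_norm_forward_sub_le (hB : ∀ x y, β * ‖B x - B y‖ ^ 2 ≤ ⟪B x - B y, x - y⟫_ℝ) {γ : ℝ}
    (hγ : 0 ≤ γ) (x y : H) :
    ‖(x - γ • B x) - (y - γ • B y)‖ ^ 2 + γ * (2 * β - γ) * ‖B x - B y‖ ^ 2 ≤ ‖x - y‖ ^ 2 := by
  have h1 := norm_sub_sq_real (x - y) (γ • (B x - B y))
  rw [show (x - y) - γ • (B x - B y) = (x - γ • B x) - (y - γ • B y) by module,
    real_inner_smul_right, norm_smul, mul_pow, Real.norm_eq_abs, sq_abs, real_inner_comm] at h1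
  have h2 := mul_le_mul_of_nonneg_left (hB x y) hγ
  nlinarith

lemma norm_forward_sub_le (hB : ∀ x y, β * ‖B x - B y‖ ^ 2 ≤ ⟪B x - B y, x - y⟫_ℝ) {γ : ℝ}
    (hγ : 0 ≤ γ) (hγβ : γ ≤ 2 * β) (x y : H) :
    ‖(x - γ • B x) - (y - γ • B y)‖ ≤ ‖x - y‖ := by
  have h := sq_norm_forward_sub_le hB hγ x y
  have h1 : 0 ≤ γ * (2 * β - γ) * ‖B x - B y‖ ^ 2 :=
    mul_nonneg (mul_nonneg hγ (by linarith)) (sq_nonneg _)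
  exact (sq_le_sq₀ (norm_nonneg _) (norm_nonneg _)).1 (by linarith)

lemma resolventMap_forward_eq_self [CompleteSpace H] (hA : IsMaximalMonotone A) {γ : ℝ}
    (hγ : 0 < γ) {z : H} (hz : -B z ∈ A z) :
    resolventMap (fun x => γ • A x) (z - γ • B z) = z := by
  rw [sub_eq_add_neg, ← smul_neg]
  exact hA.resolventMap_add_smul hγ hz

/-- Chains the forward estimate with firm nonexpansiveness of the resolvent, using that `z` is fixed
by the step. The two extra terms are the decrease that drives convergence. -/
lemma sq_norm_forwardBackward_sub_le [CompleteSpace H] (hA : IsMaximalMonotone A)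
    (hB : ∀ x y, β * ‖B x - B y‖ ^ 2 ≤ ⟪B x - B y, x - y⟫_ℝ) {γ : ℝ} (hγ : 0 < γ) {z : H}
    (hz : -B z ∈ A z) (x : H) :
    ‖resolventMap (fun x => γ • A x) (x - γ • B x) - z‖ ^ 2 +
      γ * (2 * β - γ) * ‖B x - B z‖ ^ 2 +
      ‖x - resolventMap (fun x => γ • A x) (x - γ • B x) - γ • (B x - B z)‖ ^ 2 ≤
      ‖x - z‖ ^ 2 := by
  have h1 := sq_norm_forward_sub_le hB hγ.le x z
  have h2 := hA.sq_norm_resolventMap_sub_le hγ (x - γ • B x) (z - γ • B z)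
  rw [resolventMap_forward_eq_self hA hγ hz] at h2
  set p := resolventMap (fun x => γ • A x) (x - γ • B x)
  rw [show (x - γ • B x - p) - (z - γ • B z - z) = x - p - γ • (B x - B z) by module] at h2
  linarith

lemma sq_norm_convexCombination_le {t : ℝ} (h0 : 0 ≤ t) (h1 : t ≤ 1) (a b : H) :
    ‖t • a + (1 - t) • b‖ ^ 2 ≤ t * ‖a‖ ^ 2 + (1 - t) * ‖b‖ ^ 2 := by
  have h2 := norm_add_sq_real (t • a) ((1 - t) • b)
  rw [real_inner_smul_left, real_inner_smul_right, norm_smul, norm_smul, mul_pow, mul_pow,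
    Real.norm_eq_abs, Real.norm_eq_abs, sq_abs, sq_abs] at h2
  have h3 := norm_sub_sq_real a b
  have h4 : 0 ≤ t * (1 - t) * ‖a - b‖ ^ 2 :=
    mul_nonneg (mul_nonneg h0 (by linarith)) (sq_nonneg _)
  rw [h3] at h4
  nlinarith

/-- Every weak cluster point of a forward-backward sequence along which `B (x n)` converges to
`B z` and the residuals vanish is a zero of `A + B`. -/
lemma neg_mem_of_weak_cluster_point [CompleteSpace H] (hA : IsMaximalMonotone A)
    (hB : ∀ x y, β * ‖B x - B y‖ ^ 2 ≤ ⟪B x - B y, x - y⟫_ℝ) (hβ : 0 < β) {ε : ℝ} (hε : 0 < ε)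
    {γ : ℕ → ℝ} (hγ : ∀ n, ε ≤ γ n) {x : ℕ → H} {z l : H} {R : ℝ} (hR : ∀ n, ‖x n‖ ≤ R)
    {U : Ultrafilter ℕ} (hU : (U : Filter ℕ) ≤ atTop)
    (hl : ∀ y : H, Tendsto (fun n => ⟪x n, y⟫_ℝ) U (𝓝 ⟪l, y⟫_ℝ))
    (hBx : Tendsto (fun n => B (x n)) atTop (𝓝 (B z)))
    (hres : Tendsto (fun n => x n - resolventMap (fun y => γ n • A y) (x n - γ n • B (x n))
      - γ n • (B (x n) - B z)) atTop (𝓝 0))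
    (hres' : Tendsto (fun n => x n - resolventMap (fun y => γ n • A y) (x n - γ n • B (x n)))
      atTop (𝓝 0)) :
    -B l ∈ A l := by
  have hweak : ∀ {u : ℕ → H} {v : H}, Tendsto u U (𝓝 v) →
      Tendsto (fun n => ⟪x n - l, u n⟫_ℝ) U (𝓝 0) := by
    intro u v hu
    have h1 := (tendsto_inner_of_weak_of_strong hR hl hu).sub (tendsto_const_nhds.inner hu
      (f := fun _ => l) (𝕜 := ℝ))
    simpa [inner_sub_left] using h1
  -- Cocoercivity bounds `β * ‖B (x n) - B l‖ ^ 2` by a pairing of a weakly null family with a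
  -- strongly convergent one.
  have hBl : B l = B z := by
    have h1 : Tendsto (fun n => ⟪x n - l, B (x n) - B l⟫_ℝ) U (𝓝 0) :=
      hweak ((hBx.mono_left hU).sub_const _)
    have h2 : Tendsto (fun n => ‖B (x n) - B l‖ ^ 2) U (𝓝 0) := by
      have h3 := h1.const_mul β⁻¹
      rw [mul_zero] at h3
      refine squeeze_zero (fun n => sq_nonneg _) (fun n => ?_) h3
      rw [inv_mul_eq_div, le_div_iff₀ hβ, real_inner_comm, mul_comm]
      exact hB _ _
    have h3 : Tendsto (fun n => ‖B (x n) - B l‖ ^ 2) U (𝓝 (‖B z - B l‖ ^ 2)) :=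
      ((hBx.mono_left hU).sub_const _).norm.pow 2
    have h4 := tendsto_nhds_unique h3 h2
    have h5 : ‖B z - B l‖ = 0 := (pow_eq_zero_iff two_ne_zero).1 h4
    exact (sub_eq_zero.1 (norm_eq_zero.1 h5)).symm
  rw [hBl]
  refine hA.mem_of_forall fun y v hv => ?_
  set p : ℕ → H := fun n => resolventMap (fun y => γ n • A y) (x n - γ n • B (x n)) with hp
  have hγ0 : ∀ n, 0 < γ n := fun n => hε.trans_le (hγ n)
  let u : ℕ → H := fun n => (γ n)⁻¹ • (x n - γ n • B (x n) - p n)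
  have hu : Tendsto u atTop (𝓝 (-B z)) := by
    have h1 : Tendsto (fun n => (γ n)⁻¹ • (x n - p n - γ n • (B (x n) - B z))) atTop (𝓝 0) := by
      have h2 := hres.norm.const_mul ε⁻¹
      rw [norm_zero, mul_zero] at h2
      refine squeeze_zero_norm (fun n => ?_) h2
      rw [norm_smul, norm_inv, Real.norm_of_nonneg (hγ0 n).le]
      have := hγ n
      gcongr
    have h2 := h1.sub_const (B z)
    rw [zero_sub] at h2
    refine h2.congr fun n => ?_
    simp only [u]
    rw [show x n - p n - γ n • (B (x n) - B z) = (x n - γ n • B (x n) - p n) + γ n • B z by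
      module, smul_add, inv_smul_smul₀ (hγ0 n).ne', add_sub_cancel_right]
  have hmono : ∀ n, 0 ≤ ⟪y - p n, v - u n⟫_ℝ := fun n =>
    hA.1 _ _ _ _ hv (hA.resolventMap_mem (hγ0 n) (x n - γ n • B (x n)))
  have hvu : Tendsto (fun n => v - u n) U (𝓝 (v - -B z)) := (hu.mono_left hU).const_sub v
  -- Splits `y - p n` so that the weakly convergent part is only ever paired with the strongly
  -- convergent `v - u n`.
  have h1 : Tendsto (fun n => ⟪y - l, v - u n⟫_ℝ - ⟪x n - l, v - u n⟫_ℝ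
      + ⟪x n - p n, v - u n⟫_ℝ) U (𝓝 (⟪y - l, v - -B z⟫_ℝ - 0 + ⟪(0 : H), v - -B z⟫_ℝ)) :=
    ((tendsto_const_nhds.inner hvu).sub (hweak hvu)).add ((hres'.mono_left hU).inner hvu)
  rw [inner_zero_left, sub_zero, add_zero] at h1
  refine ge_of_tendsto h1 (Eventually.of_forall fun n => ?_)
  have h2 := hmono n
  rw [show y - p n = (y - l) - (x n - l) + (x n - p n) by abel, inner_add_left,
    inner_sub_left] at h2
  exact h2

/-- Weak convergence of the relaxed forward-backward algorithm with summable errors. -/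
theorem exists_weak_limit_of_inexact_forwardBackward [CompleteSpace H] (hA : IsMaximalMonotone A)
    (hB : ∀ x y, β * ‖B x - B y‖ ^ 2 ≤ ⟪B x - B y, x - y⟫_ℝ) (hβ : 0 < β)
    (hsol : ∃ z, -B z ∈ A z) {ε : ℝ} (hε : 0 < ε)
    {γ lam : ℕ → ℝ} (hγ : ∀ n, γ n ∈ Set.Icc ε (2 * β - ε))
    (hlam : ∀ n, lam n ∈ Set.Icc 0 (1 - ε)) {x : ℕ → H} {e : ℕ → ℝ} (he : Summable e)
    (hx : ∀ n, ‖x (n + 1) - (lam n • x n + (1 - lam n) •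
      resolventMap (fun y => γ n • A y) (x n - γ n • B (x n)))‖ ≤ e n) :
    ∃ l, -B l ∈ A l ∧ ∀ y : H, Tendsto (fun n => ⟪x n, y⟫_ℝ) atTop (𝓝 ⟪l, y⟫_ℝ) := by
  obtain ⟨z₀, hz₀⟩ := hsol
  have hγ0 : ∀ n, 0 < γ n := fun n => hε.trans_le (hγ n).1
  have he0 : ∀ n, 0 ≤ e n := fun n => (norm_nonneg _).trans (hx n)
  set p : ℕ → H := fun n => resolventMap (fun y => γ n • A y) (x n - γ n • B (x n)) with hp
  have hstep : ∀ z, -B z ∈ A z → ∀ n,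
      ‖lam n • x n + (1 - lam n) • p n - z‖ ^ 2 ≤ ‖x n - z‖ ^ 2 -
        (ε * (ε ^ 2 * ‖B (x n) - B z‖ ^ 2 + ‖x n - p n - γ n • (B (x n) - B z)‖ ^ 2)) := by
    intro z hz n
    have h1 := sq_norm_forwardBackward_sub_le hA hB (hγ0 n) hz (x n)
    have h2 := sq_norm_convexCombination_le (hlam n).1 (by linarith [(hlam n).2]) (x n - z)
      (p n - z)
    rw [show lam n • (x n - z) + (1 - lam n) • (p n - z) =
      lam n • x n + (1 - lam n) • p n - z by module] at h2
    -- Both factors are at least `ε`.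
    have h3 : ε ^ 2 ≤ γ n * (2 * β - γ n) := by nlinarith [(hγ n).1, (hγ n).2]
    have h4 := mul_le_mul_of_nonneg_right h3 (sq_nonneg ‖B (x n) - B z‖)
    set D := ε ^ 2 * ‖B (x n) - B z‖ ^ 2 + ‖x n - p n - γ n • (B (x n) - B z)‖ ^ 2
    have h5 : ‖p n - z‖ ^ 2 ≤ ‖x n - z‖ ^ 2 - D := by simp only [D, hp]; linarith
    have h6 : 0 ≤ D := by positivity
    have h7 : ε ≤ 1 - lam n := by linarith [(hlam n).2]
    nlinarith
  have hnonexp : ∀ z, -B z ∈ A z → ∀ n,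
      ‖lam n • x n + (1 - lam n) • p n - z‖ ≤ ‖x n - z‖ := by
    intro z hz n
    refine (sq_le_sq₀ (norm_nonneg _) (norm_nonneg _)).1 ((hstep z hz n).trans ?_)
    have : 0 ≤ ε * (ε ^ 2 * ‖B (x n) - B z‖ ^ 2 + ‖x n - p n - γ n • (B (x n) - B z)‖ ^ 2) := by
      positivity
    linarith
  have hle : ∀ z n, ‖x (n + 1) - z‖ ≤ ‖lam n • x n + (1 - lam n) • p n - z‖ + e n := by
    intro z n
    have h1 := norm_add_le (x (n + 1) - (lam n • x n + (1 - lam n) • p n))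
      (lam n • x n + (1 - lam n) • p n - z)
    rw [sub_add_sub_cancel] at h1
    linarith [hx n]
  have hquasi : ∀ z, -B z ∈ A z →
      (∃ d, Tendsto (fun n => ‖x n - z‖ ^ 2) atTop (𝓝 d)) ∧
      Tendsto (fun n => ε * (ε ^ 2 * ‖B (x n) - B z‖ ^ 2 +
        ‖x n - p n - γ n • (B (x n) - B z)‖ ^ 2)) atTop (𝓝 0) := by
    intro z hz
    obtain ⟨C, hC⟩ := exists_bound_of_le_one_add_mul_add (α := fun n => ‖x n - z‖)
      (η := fun _ => 0) (fun n => norm_nonneg _) (fun _ => le_rfl) he0 summable_zero he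
      (fun n => by simpa using (hle z n).trans (add_le_add_left (hnonexp z hz n) _))
    -- From squaring `s + e n` with `s ≤ C`: the cross term gives `2 * C`, and `e n ^ 2 ≤ (∑' k, e
    -- k) * e n`.
    refine exists_tendsto_of_le_sub_add (τ := fun n => (2 * C + ∑' k, e k) * e n)
      (fun n => sq_nonneg _) (fun n => by positivity) (he.mul_left _) fun n => ?_
    have h1 := hle z n
    have h2 := hstep z hz n
    have h3 := (hnonexp z hz n).trans (hC n)
    have h4 : e n ≤ ∑' k, e k := he.le_tsum n fun k _ => he0 k
    have h5 := norm_nonneg (lam n • x n + (1 - lam n) • p n - z)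
    have h6 := pow_le_pow_left₀ (norm_nonneg _) h1 2
    have h7 := mul_le_mul_of_nonneg_right h4 (he0 n)
    have h8 := mul_le_mul_of_nonneg_right h3 (he0 n)
    nlinarith
  obtain ⟨R, hR⟩ : ∃ R, ∀ n, ‖x n‖ ≤ R := by
    obtain ⟨C, hC⟩ := exists_bound_of_le_one_add_mul_add (α := fun n => ‖x n - z₀‖)
      (η := fun _ => 0) (fun n => norm_nonneg _) (fun _ => le_rfl) he0 summable_zero he
      (fun n => by simpa using (hle z₀ n).trans (add_le_add_left (hnonexp z₀ hz₀ n) _))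
    exact ⟨C + ‖z₀‖, fun n => by
      have := norm_add_le (x n - z₀) z₀
      rw [sub_add_cancel] at this
      linarith [hC n]⟩
  have hto : ∀ {f : ℕ → H} {c : ℝ}, 0 < c → (∀ n, c * ‖f n‖ ^ 2 ≤
      ε * (ε ^ 2 * ‖B (x n) - B z₀‖ ^ 2 + ‖x n - p n - γ n • (B (x n) - B z₀)‖ ^ 2)) →
      Tendsto f atTop (𝓝 0) := by
    intro f c hc hf
    have h1 := (squeeze_zero (fun n => by positivity) hf (hquasi z₀ hz₀).2).const_mul c⁻¹
    simp only [mul_zero, inv_mul_cancel_left₀ hc.ne'] at h1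
    rw [tendsto_zero_iff_norm_tendsto_zero]
    have h2 := h1.sqrt
    simpa [Real.sqrt_sq (norm_nonneg _)] using h2
  have hBx0 : Tendsto (fun n => B (x n) - B z₀) atTop (𝓝 0) := by
    refine hto (c := ε * ε ^ 2) (by positivity) fun n => ?_
    nlinarith [mul_nonneg hε.le (sq_nonneg ‖x n - p n - γ n • (B (x n) - B z₀)‖)]
  have hres : Tendsto (fun n => x n - p n - γ n • (B (x n) - B z₀)) atTop (𝓝 0) := by
    refine hto hε fun n => mul_le_mul_of_nonneg_left ?_ hε.le
    have : 0 ≤ ε ^ 2 * ‖B (x n) - B z₀‖ ^ 2 := by positivity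
    linarith
  have hres' : Tendsto (fun n => x n - p n) atTop (𝓝 0) := by
    have h1 : Tendsto (fun n => γ n • (B (x n) - B z₀)) atTop (𝓝 0) := by
      have h2 := hBx0.norm.const_mul (2 * β)
      rw [norm_zero, mul_zero] at h2
      refine squeeze_zero_norm (fun n => ?_) h2
      rw [norm_smul, Real.norm_of_nonneg (hγ0 n).le]
      have : γ n ≤ 2 * β := by linarith [(hγ n).2]
      gcongr
    simpa using hres.add h1
  have hBx : Tendsto (fun n => B (x n)) atTop (𝓝 (B z₀)) := by
    simpa using hBx0.add_const (B z₀)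
  exact exists_weak_limit_of_opial (S := {z | -B z ∈ A z}) hR (fun z hz => (hquasi z hz).1)
    fun U l hU hl => neg_mem_of_weak_cluster_point hA hB hβ hε (fun n => (hγ n).1) hR hU hl hBx
      hres hres'

lemma Summable.mul_of_nonneg_real {f g : ℕ → ℝ} (hf : Summable f) (hg : Summable g)
    (hf0 : ∀ n, 0 ≤ f n) (hg0 : ∀ n, 0 ≤ g n) : Summable fun n => f n * g n :=
  (hf.mul_right (∑' k, g k)).of_nonneg_of_le (fun n => mul_nonneg (hf0 n) (hg0 n)) fun n =>
    mul_le_mul_of_nonneg_left (hg.le_tsum n fun k _ => hg0 k) (hf0 n)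

/-- Weak convergence of the forward-backward algorithm with perturbed operators. -/
theorem exists_weak_limit_of_perturbed_forwardBackward [CompleteSpace H]
    (hA : IsMaximalMonotone A)
    (hB : ∀ x y, β * ‖B x - B y‖ ^ 2 ≤ ⟪B x - B y, x - y⟫_ℝ) (hβ : 0 < β)
    (hsol : ∃ z, -B z ∈ A z) {ε : ℝ} (hε : 0 < ε)
    {γ lam : ℕ → ℝ} (hγ : ∀ n, γ n ∈ Set.Icc ε (2 * β - ε))
    (hlam : ∀ n, lam n ∈ Set.Icc 0 (1 - ε))
    {A' : ℕ → H → Set H} (hA' : ∀ n, IsMaximalMonotone (A' n))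
    (hAA' : ∀ ρ : ℝ, 0 < ρ → ∃ δ : ℕ → ℝ, Summable δ ∧ ∀ n y, ‖y‖ ≤ ρ →
      ‖resolventMap (fun x => γ n • A' n x) y - resolventMap (fun x => γ n • A x) y‖ ≤ δ n)
    {B' : ℕ → H → H} {κ : ℕ → ℝ} (hκ0 : ∀ n, 0 ≤ κ n) (hκ : Summable κ) {c : H}
    (hBB' : ∀ n x, ‖B' n x - B x‖ ≤ κ n * ‖x - c‖)
    {a b : ℕ → H} (ha : Summable fun n => ‖a n‖) (hb : Summable fun n => ‖b n‖)
    {μ : ℕ → ℝ} (hμ0 : ∀ n, 0 ≤ μ n) (hμ : Summable μ) {x w : ℕ → H}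
    (hw : ∀ n, w n = resolventMap (fun y => γ n • A' n y) (x n - γ n • (B' n (x n) + b n)) + a n)
    (hx : ∀ n, ‖x (n + 1) - (lam n • x n + (1 - lam n) • w n)‖ ≤ μ n * ‖x n - w n‖) :
    ∃ l, -B l ∈ A l ∧ ∀ y : H, Tendsto (fun n => ⟪x n, y⟫_ℝ) atTop (𝓝 ⟪l, y⟫_ℝ) := by
  have hsol' := hsol
  obtain ⟨z, hz⟩ := hsol
  have hγ0 : ∀ n, 0 < γ n := fun n => hε.trans_le (hγ n).1
  have hγβ : ∀ n, γ n ≤ 2 * β := fun n => by linarith [(hγ n).2]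
  have hwJ : ∀ n, ‖w n - resolventMap (fun y => γ n • A' n y) (x n - γ n • B (x n))‖ ≤
      ‖a n‖ + 2 * β * (κ n * ‖x n - c‖ + ‖b n‖) := by
    intro n
    have h1 := (hA' n).norm_resolventMap_sub_le (hγ0 n) (x n - γ n • (B' n (x n) + b n))
      (x n - γ n • B (x n))
    have h2 : ‖(x n - γ n • (B' n (x n) + b n)) - (x n - γ n • B (x n))‖ ≤
        2 * β * (κ n * ‖x n - c‖ + ‖b n‖) := by
      rw [show (x n - γ n • (B' n (x n) + b n)) - (x n - γ n • B (x n)) =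
        -(γ n • ((B' n (x n) - B (x n)) + b n)) by module, norm_neg, norm_smul,
        Real.norm_of_nonneg (hγ0 n).le]
      exact mul_le_mul (hγβ n) ((norm_add_le _ _).trans (add_le_add_left (hBB' n _) _))
        (norm_nonneg _) (by positivity)
    rw [hw n, add_sub_right_comm]
    refine (norm_add_le _ _).trans ?_
    linarith
  have hxc : ∀ n, ‖x n - c‖ ≤ ‖x n - z‖ + ‖z - c‖ := fun n => by
    simpa using norm_add_le (x n - z) (z - c)
  have hfz : ∀ n, ‖z - γ n • B z‖ ≤ ‖z‖ + 2 * β * ‖B z‖ + 1 := fun n => by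
    have h1 := norm_sub_le z (γ n • B z)
    rw [norm_smul, Real.norm_of_nonneg (hγ0 n).le] at h1
    have h2 := mul_le_mul_of_nonneg_right (hγβ n) (norm_nonneg (B z))
    linarith
  obtain ⟨δ, hδ, hδz⟩ := hAA' (‖z‖ + 2 * β * ‖B z‖ + 1) (by positivity)
  have hδ0 : ∀ n, 0 ≤ δ n := fun n => (norm_nonneg _).trans (hδz n _ (hfz n))
  let θ : ℕ → ℝ := fun n => ‖a n‖ + 2 * β * (κ n * ‖z - c‖ + ‖b n‖) + δ n
  have hθ0 : ∀ n, 0 ≤ θ n := fun n => by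
    have := hδ0 n
    have := hκ0 n
    positivity
  have hθ : Summable θ := (ha.add (((hκ.mul_right _).add hb).mul_left _)).add hδ
  -- The perturbed resolvent is compared with the exact one only at `z - γ n • B z`, so no bound on
  -- `x` is needed yet.
  have hwz : ∀ n, ‖w n - z‖ ≤ (1 + 2 * β * κ n) * ‖x n - z‖ + θ n := by
    intro n
    have h1 := (hA' n).norm_resolventMap_sub_le (hγ0 n) (x n - γ n • B (x n)) (z - γ n • B z)
    have h2 := norm_forward_sub_le hB (hγ0 n).le (hγβ n) (x n) z
    have h3 := hδz n _ (hfz n)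
    rw [resolventMap_forward_eq_self hA (hγ0 n) hz] at h3
    have h4 := norm_add₃_le
      (a := w n - resolventMap (fun y => γ n • A' n y) (x n - γ n • B (x n)))
      (b := resolventMap (fun y => γ n • A' n y) (x n - γ n • B (x n)) -
        resolventMap (fun y => γ n • A' n y) (z - γ n • B z))
      (c := resolventMap (fun y => γ n • A' n y) (z - γ n • B z) - z)
    rw [sub_add_sub_cancel, sub_add_sub_cancel] at h4
    have h5 := mul_le_mul_of_nonneg_left (mul_le_mul_of_nonneg_left (hxc n) (hκ0 n))
      (by positivity : 0 ≤ 2 * β)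
    simp only [θ]
    linarith [hwJ n]
  have hκβ0 : ∀ n, 0 ≤ 2 * β * κ n := fun n => mul_nonneg (by positivity) (hκ0 n)
  have hμκ : Summable fun n => μ n * (2 * β * κ n) :=
    hμ.mul_of_nonneg_real (hκ.mul_left _) hμ0 hκβ0
  have hμθ : Summable fun n => μ n * θ n := hμ.mul_of_nonneg_real hθ hμ0 hθ0
  have hxw : ∀ n, ‖x n - w n‖ ≤ (2 + 2 * β * κ n) * ‖x n - z‖ + θ n := fun n => by
    have h1 := norm_sub_le (x n - z) (w n - z)
    rw [sub_sub_sub_cancel_right] at h1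
    linarith [hwz n]
  obtain ⟨C, hC⟩ := exists_bound_of_le_one_add_mul_add (α := fun n => ‖x n - z‖)
    (η := fun n => 2 * β * κ n + (μ n * 2 + μ n * (2 * β * κ n)))
    (θ := fun n => θ n + μ n * θ n) (fun n => norm_nonneg _)
    (fun n => by have := hκ0 n; have := hμ0 n; positivity)
    (fun n => by have := hθ0 n; have := hμ0 n; positivity)
    ((hκ.mul_left _).add ((hμ.mul_right _).add hμκ)) (hθ.add hμθ) (fun n => by
      have h1 := norm_add₃_le (a := x (n + 1) - (lam n • x n + (1 - lam n) • w n))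
        (b := lam n • (x n - z)) (c := (1 - lam n) • (w n - z))
      rw [show x (n + 1) - (lam n • x n + (1 - lam n) • w n) + lam n • (x n - z) +
        (1 - lam n) • (w n - z) = x (n + 1) - z by module, norm_smul, norm_smul,
        Real.norm_of_nonneg (hlam n).1,
        Real.norm_of_nonneg (by linarith [(hlam n).2] : 0 ≤ 1 - lam n)] at h1
      have h2 := mul_le_mul_of_nonneg_left (hxw n) (hμ0 n)
      have h3 := hx n
      have h4 := mul_le_mul_of_nonneg_left (hwz n) (by linarith [(hlam n).2] : 0 ≤ 1 - lam n)
      have h5 : 0 ≤ lam n * (2 * β * κ n * ‖x n - z‖ + θ n) :=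
        mul_nonneg (hlam n).1 (add_nonneg (mul_nonneg (hκβ0 n) (norm_nonneg _)) (hθ0 n))
      nlinarith)
  have hC0 : 0 ≤ C := (norm_nonneg _).trans (hC 0)
  have hfx : ∀ n, ‖x n - γ n • B (x n)‖ ≤ C + (‖z‖ + 2 * β * ‖B z‖ + 1) := fun n => by
    have h1 := norm_add_le ((x n - γ n • B (x n)) - (z - γ n • B z)) (z - γ n • B z)
    rw [sub_add_cancel] at h1
    linarith [hfz n, hC n, norm_forward_sub_le hB (hγ0 n).le (hγβ n) (x n) z]
  -- With the orbit bounded by `hC`, this ball contains all its forward images, so the resolvent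
  -- error there is summable too.
  obtain ⟨δ', hδ', hδx⟩ := hAA' (C + (‖z‖ + 2 * β * ‖B z‖ + 1)) (by positivity)
  refine exists_weak_limit_of_inexact_forwardBackward hA hB hβ hsol' hε hγ hlam
    (e := fun n => (‖a n‖ + 2 * β * (κ n * (C + ‖z - c‖) + ‖b n‖) + δ' n) +
      ((μ n * 2 + μ n * (2 * β * κ n)) * C + μ n * θ n))
    (((ha.add (((hκ.mul_right _).add hb).mul_left _)).add hδ').add
      ((((hμ.mul_right _).add hμκ).mul_right _).add hμθ)) fun n => ?_
  have h1 := norm_add_le (x (n + 1) - (lam n • x n + (1 - lam n) • w n))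
    ((1 - lam n) • (w n - resolventMap (fun y => γ n • A y) (x n - γ n • B (x n))))
  rw [show x (n + 1) - (lam n • x n + (1 - lam n) • w n) +
    (1 - lam n) • (w n - resolventMap (fun y => γ n • A y) (x n - γ n • B (x n))) =
    x (n + 1) - (lam n • x n + (1 - lam n) •
      resolventMap (fun y => γ n • A y) (x n - γ n • B (x n))) by module, norm_smul,
    Real.norm_of_nonneg (by linarith [(hlam n).2] : 0 ≤ 1 - lam n)] at h1
  have h2 := norm_add_le (w n - resolventMap (fun y => γ n • A' n y) (x n - γ n • B (x n)))
    (resolventMap (fun y => γ n • A' n y) (x n - γ n • B (x n)) -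
      resolventMap (fun y => γ n • A y) (x n - γ n • B (x n)))
  rw [sub_add_sub_cancel] at h2
  have h3 := hδx n _ (hfx n)
  have h4 := mul_le_mul_of_nonneg_right (by linarith [(hlam n).1] : 1 - lam n ≤ 1)
    (norm_nonneg (w n - resolventMap (fun y => γ n • A y) (x n - γ n • B (x n))))
  have h5 := mul_le_mul_of_nonneg_left (mul_le_mul_of_nonneg_left
    ((hxc n).trans (add_le_add_left (hC n) _)) (hκ0 n)) (by positivity : 0 ≤ 2 * β)
  have h6 := mul_le_mul_of_nonneg_left (hxw n) (hμ0 n)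
  have h7 := mul_le_mul_of_nonneg_left (hC n)
    (mul_nonneg (hμ0 n) (by linarith [hκβ0 n] : 0 ≤ 2 + 2 * β * κ n))
  linarith [hx n, hwJ n]

end ForwardBackward

/-- Converse of Minty: if a monotone extension contains `(x, u)`, solving `x + u ∈ p + A p` and
using monotonicity of the extension forces `p = x`. -/
lemma isMaximalMonotone_of_forall_exists {H : Type*} [NormedAddCommGroup H]
    [InnerProductSpace ℝ H] {A : H → Set H} (hA : IsMonotoneOperator A)
    (h : ∀ y, ∃ p, y - p ∈ A p) : IsMaximalMonotone A := by
  refine ⟨hA, fun A' hA' hle x u hu => ?_⟩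
  obtain ⟨p, hp⟩ := h (x + u)
  have h1 := hA' _ _ _ _ hu (hle p hp)
  rw [show u - (x + u - p) = -(x - p) by abel, inner_neg_right, real_inner_self_eq_norm_sq] at h1
  have h2 : ‖x - p‖ = 0 := (pow_eq_zero_iff two_ne_zero).1 (le_antisymm (by linarith) (sq_nonneg _))
  obtain rfl : x = p := sub_eq_zero.1 (norm_eq_zero.1 h2)
  simpa using hp

/-! ### Operators on the Hilbert product -/

section Product

variable {ι : Type*} [Fintype ι] {H : ι → Type*} [∀ i, NormedAddCommGroup (H i)]

lemma PiLp.norm_le_sum_norm (x : PiLp 2 H) : ‖x‖ ≤ ∑ i, ‖x i‖ := by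
  refine (sq_le_sq₀ (norm_nonneg _) (Finset.sum_nonneg fun i _ => norm_nonneg _)).1 ?_
  rw [PiLp.norm_sq_eq_of_L2]
  exact Finset.sum_sq_le_sq_sum_of_nonneg fun i _ => norm_nonneg _

variable [∀ i, InnerProductSpace ℝ (H i)]

/-- The product of a finite family of set-valued operators. -/
def productOperator (A : ∀ i, H i → Set (H i)) (x : PiLp 2 H) : Set (PiLp 2 H) :=
  {u | ∀ i, u i ∈ A i (x i)}

variable [∀ i, CompleteSpace (H i)] {A : ∀ i, H i → Set (H i)}

lemma IsMaximalMonotone.productOperator (hA : ∀ i, IsMaximalMonotone (A i)) :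
    IsMaximalMonotone (productOperator A) := by
  refine isMaximalMonotone_of_forall_exists (fun x y u v hu hv => ?_) fun y => ?_
  · rw [PiLp.inner_apply]
    exact Finset.sum_nonneg fun i _ => (hA i).1 _ _ _ _ (hu i) (hv i)
  · refine ⟨WithLp.toLp 2 fun i => resolventMap (fun x => (1 : ℝ) • A i x) (y i), fun i => ?_⟩
    simpa using (hA i).resolventMap_mem one_pos (y i)

/-- Coordinate `i` of the product inclusion is the inclusion defining the resolvent of `A i`, whose
solution is unique. -/
lemma resolventMap_productOperator_apply (hA : ∀ i, IsMaximalMonotone (A i)) {γ : ℝ}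
    (hγ : 0 < γ) (y : PiLp 2 H) (i : ι) :
    resolventMap (fun x => γ • productOperator A x) y i =
      resolventMap (fun x => γ • A i x) (y i) := by
  have h := (hA i).resolventMap_add_smul hγ
    ((IsMaximalMonotone.productOperator hA).resolventMap_mem hγ y i)
  rw [PiLp.smul_apply, smul_inv_smul₀ hγ.ne', PiLp.sub_apply, add_sub_cancel] at h
  exact h.symm

end Product

lemma exists_summable_bound_of_tsum_iSup_lt_top {E F : Type*} [SeminormedAddCommGroup E]
    [SeminormedAddCommGroup F] {f : ℕ → E → F} {ρ : ℝ}
    (h : (∑' n, ⨆ y ∈ Metric.closedBall (0 : E) ρ, ‖f n y‖ₑ) < (∞ : ℝ≥0∞)) :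
    ∃ δ : ℕ → ℝ, Summable δ ∧ ∀ n y, ‖y‖ ≤ ρ → ‖f n y‖ ≤ δ n := by
  refine ⟨_, ENNReal.summable_toReal h.ne, fun n y hy => ?_⟩
  have h1 := ENNReal.ne_top_of_tsum_ne_top h.ne n
  rw [← toReal_enorm]
  exact ENNReal.toReal_mono h1
    (le_iSup₂_of_le y (mem_closedBall_zero_iff.2 hy) le_rfl)

/-! ### Reduction of the coupled system to one inclusion -/

theorem theoremt
    {m : ℕ} (hm : 2 ≤ m)
    {H : Fin m → Type*} [∀ i, NormedAddCommGroup (H i)] [∀ i, InnerProductSpace ℝ (H i)]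
    [∀ i, CompleteSpace (H i)]
    -- the problem
    (A : ∀ i, H i → Set (H i)) (hA : ∀ i, IsMaximalMonotone (A i))
    (B : ∀ i, PiLp 2 H → H i) (β : ℝ) (hβ : 0 < β) (hB : JointlyCocoercive β B)
    (hsol : ∃ x : PiLp 2 H, SolvesCoupledInclusions A B x)
    -- step sizes and global relaxations
    (ε : ℝ) (hε : ε ∈ Set.Ioo 0 (min 1 β))
    (γ : ℕ → ℝ) (hγ : ∀ n, γ n ∈ Set.Icc ε (2 * β - ε))
    (lam : ℕ → ℝ) (hlam : ∀ n, lam n ∈ Set.Icc 0 (1 - ε))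
    -- approximations of the operators `A i`
    (A' : ∀ i, ℕ → H i → Set (H i)) (hA' : ∀ i n, IsMaximalMonotone (A' i n))
    (hAA' : ∀ i, ∀ ρ : ℝ, 0 < ρ →
      (∑' n, ⨆ y ∈ Metric.closedBall (0 : H i) ρ,
        ‖resolventMap (fun x => γ n • A' i n x) y - resolventMap (fun x => γ n • A i x) y‖ₑ) < (∞ : ℝ≥0∞))
    -- approximations of the operators `B i`
    (B' : ∀ i, ℕ → PiLp 2 H → H i)
    (κ : Fin m → ℕ → ℝ≥0) (hκpos : ∀ i n, 0 < κ i n) (hκ : ∀ i, Summable (κ i))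
    (hBB' : ∀ i n, LipschitzWith (κ i n) (fun x => B' i n x - B i x))
    (hz : ∃ z : PiLp 2 H, ∀ i n, B' i n z = B i z)
    -- errors
    (a b : ∀ i, ℕ → H i)
    (ha : ∀ i, Summable (fun n => ‖a i n‖)) (hb : ∀ i, Summable (fun n => ‖b i n‖))
    -- agent-dependent relaxations
    (lam' : Fin m → ℕ → ℝ) (hlam' : ∀ i n, lam' i n ∈ Set.Ico 0 1)
    (hlamlam' : ∀ i, Summable (fun n => |lam' i n - lam n|))
    -- the iterates
    (x : ℕ → PiLp 2 H)
    (hx : ∀ n i, x (n + 1) i = lam' i n • x n i + (1 - lam' i n) •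
      (resolventMap (fun y => γ n • A' i n y) (x n i - γ n • (B' i n (x n) + b i n)) + a i n)) :
    ∃ xs : PiLp 2 H, (∀ i, ConvergesWeakly (fun n => x n i) (xs i)) ∧
      SolvesCoupledInclusions A B xs := by
  obtain ⟨c, hc⟩ := hz
  have hγ0 : ∀ n, 0 < γ n := fun n => hε.1.trans_le (hγ n).1
  have hsol_iff : ∀ y : PiLp 2 H, SolvesCoupledInclusions A B y ↔
      -(WithLp.toLp 2 fun i => B i y) ∈ productOperator A y := fun y => by
    refine forall_congr' fun i => ?_
    rw [Set.mem_add]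
    constructor
    · rintro ⟨u, hu, v, rfl, huv⟩
      rwa [eq_neg_of_add_eq_zero_left huv] at hu
    · exact fun h => ⟨_, h, _, rfl, by simp⟩
  obtain ⟨l, hl, hlim⟩ := exists_weak_limit_of_perturbed_forwardBackward
    (A := productOperator A) (B := fun y => WithLp.toLp 2 fun i => B i y) (β := β)
    (A' := fun n => productOperator fun i => A' i n)
    (B' := fun n y => WithLp.toLp 2 fun i => B' i n y) (γ := γ) (lam := lam)
    (κ := fun n => ∑ i, (κ i n : ℝ)) (c := c)
    (a := fun n => WithLp.toLp 2 fun i => a i n) (b := fun n => WithLp.toLp 2 fun i => b i n)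
    (μ := fun n => ∑ i, |lam' i n - lam n|) (x := x)
    (w := fun n => resolventMap (fun y => γ n • productOperator (fun i => A' i n) y)
      (x n - γ n • ((WithLp.toLp 2 fun i => B' i n (x n)) + WithLp.toLp 2 fun i => b i n)) +
        WithLp.toLp 2 fun i => a i n)
    (IsMaximalMonotone.productOperator hA)
    (fun y z => by
      rw [PiLp.norm_sq_eq_of_L2, PiLp.inner_apply]
      exact hB y z)
    hβ (hsol.imp fun y => (hsol_iff y).1) hε.1 hγ hlam
    (fun n => IsMaximalMonotone.productOperator fun i => hA' i n)
    (fun ρ hρ => by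
      choose δ hδ hδle using fun i => exists_summable_bound_of_tsum_iSup_lt_top (hAA' i ρ hρ)
      refine ⟨fun n => ∑ i, δ i n, summable_sum fun i _ => hδ i, fun n y hy => ?_⟩
      refine (PiLp.norm_le_sum_norm _).trans (Finset.sum_le_sum fun i _ => ?_)
      rw [PiLp.sub_apply, resolventMap_productOperator_apply (fun i => hA' i n) (hγ0 n),
        resolventMap_productOperator_apply hA (hγ0 n)]
      exact hδle i n (y i) ((PiLp.norm_apply_le y i).trans hy))
    (fun n => Finset.sum_nonneg fun i _ => (κ i n).2)
    (summable_sum fun i _ => NNReal.summable_coe.2 (hκ i))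
    (fun n y => by
      refine (PiLp.norm_le_sum_norm _).trans ?_
      rw [Finset.sum_mul]
      refine Finset.sum_le_sum fun i _ => ?_
      have h := (hBB' i n).norm_sub_le y c
      simpa [hc i n] using h)
    ((summable_sum fun i _ => ha i).of_nonneg_of_le (fun n => norm_nonneg _)
      fun n => PiLp.norm_le_sum_norm _)
    ((summable_sum fun i _ => hb i).of_nonneg_of_le (fun n => norm_nonneg _)
      fun n => PiLp.norm_le_sum_norm _)
    (fun n => Finset.sum_nonneg fun i _ => abs_nonneg _)
    (summable_sum fun i _ => hlamlam' i)
    (fun n => rfl)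
    (fun n => by
      refine (PiLp.norm_le_sum_norm _).trans ?_
      rw [Finset.sum_mul]
      refine Finset.sum_le_sum fun i _ => ?_
      set w := resolventMap (fun y => γ n • productOperator (fun i => A' i n) y)
        (x n - γ n • ((WithLp.toLp 2 fun i => B' i n (x n)) + WithLp.toLp 2 fun i => b i n)) +
          WithLp.toLp 2 fun i => a i n with hw
      have hwi : w i = resolventMap (fun y => γ n • A' i n y)
          (x n i - γ n • (B' i n (x n) + b i n)) + a i n := by
        rw [hw, PiLp.add_apply, resolventMap_productOperator_apply (fun i => hA' i n) (hγ0 n)]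
        rfl
      -- Replacing the individual relaxations by the common `lam n` costs exactly this term, which
      -- is what `μ` measures.
      have h1 : (x (n + 1) - (lam n • x n + (1 - lam n) • w)) i =
          (lam' i n - lam n) • (x n - w) i := by
        simp only [PiLp.sub_apply, PiLp.add_apply, PiLp.smul_apply]
        rw [hx n i, ← hwi]
        module
      rw [h1, norm_smul, Real.norm_eq_abs]
      exact mul_le_mul_of_nonneg_left (PiLp.norm_apply_le _ i) (abs_nonneg _))
  refine ⟨l, fun i => convergesWeakly_of_tendsto_inner fun y => ?_, (hsol_iff l).2 hl⟩
  -- Test vectors supported in one coordinate turn weak convergence in the product into weak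
  -- convergence of each component.
  have hsingle : ∀ v : PiLp 2 H, ⟪v, WithLp.toLp 2 (Pi.single i y)⟫_ℝ = ⟪v i, y⟫_ℝ := fun v => by
    rw [PiLp.inner_apply, Finset.sum_eq_single i]
    · simp
    · intro j _ hj
      simp [Pi.single_eq_of_ne hj]
    · simp
  simpa only [hsingle] using hlim (WithLp.toLp 2 (Pi.single i y))
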